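/- Let $F=\langle x_0,x_1,x_2,\dots \mid x_jx_i=x_ix_{j+1}\ (i<j)\rangle$ be Thompson's group, which is generated by $x_0,x_1$. A group marked by $k$ elements is a group with a distinguished generating $k$-tuple; for two such marked groups, the distance is at most $e^{-R}$ exactly when they have the same relations of length at most $R$ (for $R\in\mathbb N$), and convergence of marked groups is meant in this (pseudo)metric. Let $g_n\in F$ $(n\in\mathbb N)$ be such that the marked groups $(F,(g_n,x_0,x_1))$ converge to a marked group $(G,(g,\xi_0,\xi_1))$. Then, for every finitely generated subgroup $H\le F$ and every embedding $\alpha:H\to F$, the group $G$ is not the HNN-extension $$F*_\alpha=\langle F,t\mid tht^{-1}=\alpha(h),\ h\in H\rangle$$ of $F=\langle x_0,x_1\rangle$: there is no isomorphism $G\to F*_\alpha$ taking $\xi_0$ to $x_0$ and $\xi_1$ to $x_1$. In particular there is none that moreover takes $g$ to the stable letter $t$, i.e. $G$ is not $\langle F,g\mid ghg^{-1}=\alpha(h),\ h\in H\rangle$. -/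

import Mathlib

open Filter Topology

/-- The relators `(x_j x_i) (x_i x_{j+1})⁻¹`, `i < j`, over generators `x_0, x_1, x_2, …`. -/
def thompsonRels : Set (FreeGroup ℕ) :=
  {r | ∃ i j : ℕ, i < j ∧
    r = (FreeGroup.of j * FreeGroup.of i) * (FreeGroup.of i * FreeGroup.of (j + 1))⁻¹}

/-- Thompson's group `F = ⟨x_0, x_1, x_2, … | x_j x_i = x_i x_{j+1} (i < j)⟩`. -/
abbrev ThompsonF : Type := PresentedGroup thompsonRels

namespace ThompsonF

/-- The standard generators `x_n` of Thompson's group. -/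
def x (n : ℕ) : ThompsonF := PresentedGroup.of n

theorem x_mul_x {i j : ℕ} (h : i < j) : x j * x i = x i * x (j + 1) := by
  have : PresentedGroup.mk thompsonRels
      ((FreeGroup.of j * FreeGroup.of i) * (FreeGroup.of i * FreeGroup.of (j + 1))⁻¹) = 1 :=
    PresentedGroup.one_of_mem ⟨i, j, h, rfl⟩
  rw [map_mul, map_inv, mul_inv_eq_one, map_mul, map_mul] at this
  exact this

theorem closure_x_zero_x_one : Subgroup.closure ({x 0, x 1} : Set ThompsonF) = ⊤ := by
  have h0 : x 0 ∈ Subgroup.closure ({x 0, x 1} : Set ThompsonF) :=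
    Subgroup.subset_closure (by simp)
  have h1 : x 1 ∈ Subgroup.closure ({x 0, x 1} : Set ThompsonF) :=
    Subgroup.subset_closure (by simp)
  have hs : ∀ n : ℕ, x (n + 1) ∈ Subgroup.closure ({x 0, x 1} : Set ThompsonF) := by
    intro n
    induction n with
    | zero => exact h1
    | succ n ih =>
      have e : x (n + 1 + 1) = (x 0)⁻¹ * (x (n + 1) * x 0) := by
        rw [x_mul_x (Nat.succ_pos n)]; group
      rw [e]
      exact Subgroup.mul_mem _ (Subgroup.inv_mem _ h0) (Subgroup.mul_mem _ ih h0)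
  rw [eq_top_iff, ← PresentedGroup.closure_range_of thompsonRels, Subgroup.closure_le]
  rintro _ ⟨n, rfl⟩
  cases n with
  | zero => exact h0
  | succ n => exact hs n

end ThompsonF

/-- A group marked by a generating `k`-tuple. Marked groups that are isomorphic as marked groups
are at distance `0` in the pseudometric below, so the space of marked groups up to isomorphism is
the metric quotient of this type. -/
structure MarkedGroup (k : ℕ) where
  carrier : Type
  [group : Group carrier]
  gens : Fin k → carrier
  closure_range_gens : Subgroup.closure (Set.range gens) = ⊤

attribute [instance] MarkedGroup.group

namespace MarkedGroup

variable {k : ℕ}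

/-- The word `w` is a relation of the marked group `M`. -/
def IsRelation (M : MarkedGroup k) (w : FreeGroup (Fin k)) : Prop :=
  FreeGroup.lift M.gens w = 1

/-- `M` and `N` have exactly the same relations of length at most `R`. -/
def SameRelations (R : ℕ) (M N : MarkedGroup k) : Prop :=
  ∀ w : FreeGroup (Fin k), w.norm ≤ R → (M.IsRelation w ↔ N.IsRelation w)

theorem SameRelations.zero (M N : MarkedGroup k) : SameRelations 0 M N := by
  intro w hw
  obtain rfl : w = 1 := FreeGroup.norm_eq_zero.1 (Nat.le_zero.1 hw)
  simp [IsRelation]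

theorem SameRelations.mono {R S : ℕ} (h : R ≤ S) {M N : MarkedGroup k}
    (hS : SameRelations S M N) : SameRelations R M N :=
  fun w hw => hS w (hw.trans h)

/-- The distance on marked groups: it is at most `exp (-R)` exactly when the relations of length at
most `R` are the same (`markedDist_le_exp_iff`). -/
noncomputable def markedDist (M N : MarkedGroup k) : ℝ :=
  sInf {d : ℝ | ∃ R : ℕ, SameRelations R M N ∧ d = Real.exp (-(R : ℝ))}

theorem markedDist_set_nonempty (M N : MarkedGroup k) :
    {d : ℝ | ∃ R : ℕ, SameRelations R M N ∧ d = Real.exp (-(R : ℝ))}.Nonempty :=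
  ⟨_, 0, SameRelations.zero M N, rfl⟩

theorem markedDist_set_bddBelow (M N : MarkedGroup k) :
    BddBelow {d : ℝ | ∃ R : ℕ, SameRelations R M N ∧ d = Real.exp (-(R : ℝ))} := by
  refine ⟨0, ?_⟩
  rintro _ ⟨R, -, rfl⟩
  exact (Real.exp_pos _).le

theorem markedDist_le_of_sameRelations {R : ℕ} {M N : MarkedGroup k}
    (h : SameRelations R M N) : markedDist M N ≤ Real.exp (-(R : ℝ)) :=
  csInf_le (markedDist_set_bddBelow M N) ⟨R, h, rfl⟩

theorem markedDist_le_exp_iff (R : ℕ) (M N : MarkedGroup k) :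
    markedDist M N ≤ Real.exp (-(R : ℝ)) ↔ SameRelations R M N := by
  refine ⟨fun h => ?_, markedDist_le_of_sameRelations⟩
  by_contra hR
  have key : Real.exp (-(R : ℝ) + 1) ≤ markedDist M N := by
    refine le_csInf (markedDist_set_nonempty M N) ?_
    rintro _ ⟨S, hS, rfl⟩
    have hlt : S + 1 ≤ R := by
      by_contra hc
      exact hR (hS.mono (by omega))
    have hlt' : (S : ℝ) + 1 ≤ R := by exact_mod_cast hlt
    exact Real.exp_le_exp.2 (by linarith)
  have : Real.exp (-(R : ℝ)) < Real.exp (-(R : ℝ) + 1) := Real.exp_lt_exp.2 (by linarith)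
  linarith

noncomputable instance : PseudoMetricSpace (MarkedGroup k) where
  dist := markedDist
  dist_self M := by
    refine le_antisymm ?_ (le_csInf (markedDist_set_nonempty M M) ?_)
    · have ht : Tendsto (fun R : ℕ => Real.exp (-(R : ℝ))) atTop (𝓝 0) :=
        Real.tendsto_exp_neg_atTop_nhds_zero.comp tendsto_natCast_atTop_atTop
      exact ge_of_tendsto' ht fun R => markedDist_le_of_sameRelations fun _ _ => Iff.rfl
    · rintro _ ⟨R, -, rfl⟩
      exact (Real.exp_pos _).le
  dist_comm M N := by
    have h : ∀ R, SameRelations R M N ↔ SameRelations R N M := fun R =>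
      ⟨fun h w hw => (h w hw).symm, fun h w hw => (h w hw).symm⟩
    simp only [markedDist, h]
  dist_triangle M N P := by
    have h1 : ∀ R S : ℕ, SameRelations R M N → SameRelations S N P →
        markedDist M P ≤ Real.exp (-(R : ℝ)) + Real.exp (-(S : ℝ)) := by
      intro R S hR hS
      have hp := Real.exp_pos (-(R : ℝ))
      have hq := Real.exp_pos (-(S : ℝ))
      rcases le_total R S with h | h
      · have := markedDist_le_of_sameRelations (M := M) (N := P) (R := R)
          fun w hw => (hR w hw).trans (hS.mono h w hw)
        linarith
      · have := markedDist_le_of_sameRelations (M := M) (N := P) (R := S)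
          fun w hw => (hR.mono h w hw).trans (hS w hw)
        linarith
    have h2 : ∀ R : ℕ, SameRelations R M N →
        markedDist M P - Real.exp (-(R : ℝ)) ≤ markedDist N P := by
      intro R hR
      refine le_csInf (markedDist_set_nonempty N P) ?_
      rintro _ ⟨S, hS, rfl⟩
      linarith [h1 R S hR hS]
    have h3 : markedDist M P - markedDist N P ≤ markedDist M N := by
      refine le_csInf (markedDist_set_nonempty M N) ?_
      rintro _ ⟨R, hR, rfl⟩
      linarith [h2 R hR]
    linarith

end MarkedGroup

/-- Thompson's group marked by the triple `(g, x_0, x_1)`. -/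
def ThompsonF.marked (g : ThompsonF) : MarkedGroup 3 where
  carrier := ThompsonF
  gens := ![g, ThompsonF.x 0, ThompsonF.x 1]
  closure_range_gens := by
    rw [eq_top_iff, ← ThompsonF.closure_x_zero_x_one]
    refine Subgroup.closure_mono ?_
    rintro y (rfl | rfl)
    · exact ⟨1, rfl⟩
    · exact ⟨2, rfl⟩

/-- For a subgroup `H` of `K` and an embedding `α : H → K`, the HNN-extension
`⟨K, t | t h t⁻¹ = α h, h ∈ H⟩` with stable letter `HNNExtension.t`. -/
abbrev HNNOfEmbedding {K : Type} [Group K] (H : Subgroup K) (α : H →* K)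
    (hα : Function.Injective α) : Type :=
  HNNExtension K H α.range (MonoidHom.ofInjective hα)

/-!
Why no such limit exists. Let `t` be the stable letter, a word in `g, x 0, x 1`, and let `t_n` be the
value of this word at `g n, x 0, x 1`. An equation with constants from `F` holds for `t` in the
HNN-extension exactly when it holds for `t_n` for all large `n`. As `H` is finitely generated,
`t_n * h * t_n⁻¹ = α h` holds on all of `H` for large `n`. Hence `α` is conjugation by some `f` in
`F`, and the elements `s_n = f⁻¹ * t_n` eventually lie in the centraliser `C` of `H` in `F`.

If `C` is trivial, then `t = f` in the HNN-extension, which is absurd. Otherwise choose `c ≠ 1`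
in `C`. In the piecewise linear action of `F` on the line, `c` moves some point `p` to the left of
which, resp. to the right of which, there is an element `a`, resp. `b`, of `F` whose support ends
exactly at `p`. An element commuting with `a` or `b` has to fix `p`, so `a` and `b` do not commute
with `c` and do not lie in `H`. But any `s` in `F` pushes `p` to the right or to the left, and
accordingly `s * b * s⁻¹` has support disjoint from that of `a`, or `s * a * s⁻¹` from that of `b`
(`ThompsonF.exists_not_commute_forall_commute_conj`). So one of the two resulting commutation
relations holds for `s_n` for infinitely many `n`, hence for `s = f⁻¹ * t`, and this contradicts
Britton's lemma (`HNNOfEmbedding.not_commute_of_notMem`).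

Since `F` is given by its presentation, faithfulness of the action has to be proved. Every element
is a quotient of positive words, each of which can be written with a least letter first. If two
such words have the same first letter, it is cancelled by a conjugation; if not, the two words act
differently at an integer. The same argument shows that a nontrivial element moves a point in the
orbit of the integers `≥ 2` (`ThompsonF.eq_one_of_fixesOrbit`), which are the points at which the
elements `a` and `b` are explicit.
-/

/-! ### The piecewise linear action -/

namespace ThompsonF

/-- The increasing homeomorphism of `ℚ` that is the identity on `(-∞, n]`, has slope `1/2` on
`[n, n + 2]`, and is translation by `-1` on `[n + 2, ∞)`. -/
def contraction (n : ℕ) : ℚ ≃o ℚ where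
  toFun y := min y (max ((y + n) / 2) (y - 1))
  invFun y := max y (min (2 * y - n) (y + 1))
  left_inv y := by grind
  right_inv y := by grind
  map_rel_iff' {y z} := by
    simp only [Equiv.coe_fn_mk]
    grind

theorem contraction_apply (n : ℕ) (y : ℚ) :
    contraction n y = min y (max ((y + n) / 2) (y - 1)) := rfl

theorem contraction_mul {i j : ℕ} (h : i < j) :
    contraction j * contraction i = contraction i * contraction (j + 1) := by
  have h' : (i : ℚ) + 1 ≤ j := by exact_mod_cast h
  ext y
  simp only [RelIso.mul_apply, contraction_apply]
  push_cast
  grind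

/-- The action of Thompson's group on `ℚ` by piecewise linear order automorphisms, in which `x n`
acts by `contraction n`. -/
def action : ThompsonF →* (ℚ ≃o ℚ) :=
  PresentedGroup.toGroup (f := contraction) (by
    rintro r ⟨i, j, h, rfl⟩
    rw [map_mul, map_inv, mul_inv_eq_one]
    simpa using contraction_mul h)

theorem action_x (n : ℕ) : action (x n) = contraction n :=
  PresentedGroup.toGroup.of _

theorem action_x_le (n : ℕ) (y : ℚ) : action (x n) y ≤ y := by
  rw [action_x, contraction_apply]
  exact min_le_left _ _

theorem action_x_eq_self_iff (n : ℕ) (y : ℚ) : action (x n) y = y ↔ y ≤ n := by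
  rw [action_x, contraction_apply]
  grind

theorem action_x_add_two (n : ℕ) : action (x n) ((n : ℚ) + 2) = n + 1 := by
  rw [action_x, contraction_apply]
  grind

/-- The element `x j * (x (j + 1))⁻¹` has support exactly the open interval `(j, j + 2)`. -/
theorem action_x_mul_inv_eq_self_iff (j : ℕ) (y : ℚ) :
    action (x j * (x (j + 1))⁻¹) y = y ↔ y ≤ j ∨ (j : ℚ) + 2 ≤ y := by
  obtain ⟨z, rfl⟩ := (action (x (j + 1))).surjective y
  rw [map_mul, map_inv, RelIso.mul_apply, RelIso.inv_apply_self, action_x, action_x,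
    contraction_apply, contraction_apply]
  push_cast
  grind

/-! ### Positive words and faithfulness of the action -/

/-- The positive word `x l₀ * x l₁ * ⋯`. -/
def positive (l : List ℕ) : ThompsonF := (l.map x).prod

@[simp] theorem positive_nil : positive [] = 1 := rfl

@[simp] theorem positive_cons (i : ℕ) (l : List ℕ) : positive (i :: l) = x i * positive l := by
  simp [positive]

theorem inv_x_mul_positive (l : List ℕ) (i : ℕ) :
    ∃ l' m' : List ℕ, (x i)⁻¹ * positive l = positive l' * (positive m')⁻¹ := by
  induction l generalizing i with
  | nil => exact ⟨[], [i], by simp⟩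
  | cons j l ih =>
    rcases lt_trichotomy i j with h | rfl | h
    · obtain ⟨l', m', e⟩ := ih i
      refine ⟨(j + 1) :: l', m', ?_⟩
      have hx : (x i)⁻¹ * x j = x (j + 1) * (x i)⁻¹ := by
        rw [eq_mul_inv_iff_mul_eq, mul_assoc, x_mul_x h, inv_mul_cancel_left]
      rw [positive_cons, positive_cons, ← mul_assoc, hx, mul_assoc, e, mul_assoc]
    · exact ⟨l, [], by simp⟩
    · obtain ⟨l', m', e⟩ := ih (i + 1)
      refine ⟨j :: l', m', ?_⟩
      have hx : (x i)⁻¹ * x j = x j * (x (i + 1))⁻¹ := by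
        rw [eq_mul_inv_iff_mul_eq, mul_assoc, ← x_mul_x h, inv_mul_cancel_left]
      rw [positive_cons, positive_cons, ← mul_assoc, hx, mul_assoc, e, mul_assoc]

/-- Thompson's group is the group of right fractions of its positive monoid. -/
theorem exists_eq_positive_mul_inv (g : ThompsonF) :
    ∃ l m : List ℕ, g = positive l * (positive m)⁻¹ := by
  have hg : g ∈ Subgroup.closure (Set.range (PresentedGroup.of (rels := thompsonRels))) := by
    rw [PresentedGroup.closure_range_of]
    trivial
  induction hg using Subgroup.closure_induction_left with
  | one => exact ⟨[], [], by simp⟩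
  | mul_left y hy g _ ih =>
    obtain ⟨i, rfl⟩ := hy
    obtain ⟨l, m, rfl⟩ := ih
    exact ⟨i :: l, m, by rw [positive_cons, mul_assoc]; rfl⟩
  | inv_mul_cancel y hy g _ ih =>
    obtain ⟨i, rfl⟩ := hy
    obtain ⟨l, m, rfl⟩ := ih
    obtain ⟨l', m', e⟩ := inv_x_mul_positive l i
    refine ⟨l', m ++ m', ?_⟩
    have : positive (m ++ m') = positive m * positive m' := by simp [positive]
    rw [this, mul_inv_rev, ← mul_assoc, ← mul_assoc, ← e]
    rfl

/-- A nonempty positive word can be rewritten, without changing its length, so that its first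
letter has the least index. -/
theorem exists_positive_eq_least_first (l : List ℕ) : l = [] ∨ ∃ (i : ℕ) (l' : List ℕ),
    positive l = x i * positive l' ∧ (∀ k ∈ l', i ≤ k) ∧ l'.length + 1 = l.length := by
  induction l with
  | nil => exact .inl rfl
  | cons j l ih =>
    right
    obtain rfl | ⟨i, l', e, hl', hlen⟩ := ih
    · exact ⟨j, [], by simp⟩
    · rcases le_or_gt j i with h | h
      · refine ⟨j, i :: l', by rw [positive_cons, positive_cons, e], ?_, by simp [hlen]⟩
        rintro k (_ | ⟨_, hk⟩)
        · exact h
        · exact h.trans (hl' k hk)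
      · refine ⟨i, (j + 1) :: l', ?_, ?_, by simp [hlen]⟩
        · rw [positive_cons, positive_cons, e, ← mul_assoc, x_mul_x h, mul_assoc]
        · rintro k (_ | ⟨_, hk⟩)
          · omega
          · exact hl' k hk

theorem action_positive_le (l : List ℕ) (y : ℚ) : action (positive l) y ≤ y := by
  induction l with
  | nil => simp
  | cons i l ih =>
    rw [positive_cons, map_mul, RelIso.mul_apply]
    exact (action_x_le i _).trans ih

theorem action_positive_eq_self {m : List ℕ} {y : ℚ} (h : ∀ k ∈ m, y ≤ k) :
    action (positive m) y = y := by
  induction m with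
  | nil => simp
  | cons i m ih =>
    rw [positive_cons, map_mul, RelIso.mul_apply, ih fun k hk => h k (List.mem_cons_of_mem _ hk)]
    exact (action_x_eq_self_iff i y).2 (h i List.mem_cons_self)

/-- All conjugates of `c` fix all integers `≥ 2`; equivalently, `c` fixes the orbit of `2`, which is
the set of positive dyadic rationals. -/
def FixesOrbit (c : ThompsonF) : Prop :=
  ∀ (f : ThompsonF) (j : ℕ), action (f⁻¹ * c * f) ((j : ℚ) + 2) = j + 2

theorem FixesOrbit.inv {c : ThompsonF} (h : FixesOrbit c) : FixesOrbit c⁻¹ := by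
  intro f j
  have e : f⁻¹ * c⁻¹ * f = (f⁻¹ * c * f)⁻¹ := by group
  rw [e, map_inv]
  conv_lhs => rw [← h f j]
  exact RelIso.inv_apply_self _ _

theorem FixesOrbit.conj {c : ThompsonF} (h : FixesOrbit c) (k : ThompsonF) :
    FixesOrbit (k⁻¹ * c * k) := by
  intro f j
  have e : f⁻¹ * (k⁻¹ * c * k) * f = (k * f)⁻¹ * c * (k * f) := by group
  rw [e]
  exact h _ j

/-- A positive word with first letter `x i` moves `i + 1` to the left, while a positive word in
letters of larger index fixes it. -/
theorem not_fixesOrbit {i : ℕ} {m : List ℕ} (l : List ℕ) (hm : ∀ k ∈ m, i + 1 ≤ k) :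
    ¬ FixesOrbit (x i * positive l * (positive m)⁻¹) := by
  intro h
  have h1 := congrArg (action (x i)) (h (x i) i)
  rw [← RelIso.mul_apply, ← map_mul, mul_assoc, mul_inv_cancel_left, map_mul, RelIso.mul_apply,
    action_x_add_two, map_mul, RelIso.mul_apply, map_inv] at h1
  have h2 : action (positive m) ((i : ℚ) + 1) = i + 1 :=
    action_positive_eq_self fun k hk => by exact_mod_cast hm k hk
  have h3 : (action (positive m))⁻¹ ((i : ℚ) + 1) = i + 1 := by
    conv_lhs => rw [← h2]
    exact RelIso.inv_apply_self _ _
  rw [h3, map_mul, RelIso.mul_apply] at h1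
  have h4 := (action (x i)).monotone (action_positive_le l ((i : ℚ) + 1))
  rw [h1] at h4
  have h5 := (action_x_eq_self_iff i ((i : ℚ) + 1)).1 (le_antisymm (action_x_le _ _) h4)
  linarith

theorem positive_eq_of_fixesOrbit (l m : List ℕ)
    (h : FixesOrbit (positive l * (positive m)⁻¹)) : positive l = positive m := by
  induction hn : l.length generalizing l m with
  | zero =>
    obtain rfl := List.length_eq_zero_iff.1 hn
    obtain rfl | ⟨j, m', em, -, -⟩ := exists_positive_eq_least_first m
    · rfl
    · refine absurd h.inv ?_
      rw [mul_inv_rev, inv_inv, em]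
      exact not_fixesOrbit m' (by simp)
  | succ n ih =>
    obtain rfl | ⟨i, l', el, hl', hlen⟩ := exists_positive_eq_least_first l
    · simp at hn
    obtain rfl | ⟨j, m', em, hm', -⟩ := exists_positive_eq_least_first m
    · rw [el] at h
      exact absurd h (not_fixesOrbit l' (by simp))
    rcases lt_trichotomy i j with hij | rfl | hij
    · refine absurd h ?_
      rw [el, em, ← positive_cons j]
      refine not_fixesOrbit l' ?_
      rintro k (_ | ⟨_, hk⟩)
      · exact hij
      · exact hij.trans_le (hm' k hk)
    · rw [el, em] at h ⊢
      have e : (x i)⁻¹ * (x i * positive l' * (x i * positive m')⁻¹) * x i =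
          positive l' * (positive m')⁻¹ := by group
      rw [ih l' m' (e ▸ h.conj (x i)) (by omega)]
    · refine absurd h.inv ?_
      rw [mul_inv_rev, inv_inv, el, em, ← positive_cons i]
      refine not_fixesOrbit m' ?_
      rintro k (_ | ⟨_, hk⟩)
      · exact hij
      · exact hij.trans_le (hl' k hk)

theorem eq_one_of_fixesOrbit {c : ThompsonF} (h : FixesOrbit c) : c = 1 := by
  obtain ⟨l, m, rfl⟩ := exists_eq_positive_mul_inv c
  rw [positive_eq_of_fixesOrbit l m h, mul_inv_cancel]

theorem action_injective : Function.Injective action := by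
  refine (injective_iff_map_eq_one action).2 fun c hc => eq_one_of_fixesOrbit fun f j => ?_
  simp [hc]

end ThompsonF

/-! ### Commutation of order automorphisms -/

section OrderAutomorphisms

variable {a b d : ℚ ≃o ℚ} {p q : ℚ}

theorem commute_of_fixed_Ici_Iic (ha : ∀ y, p ≤ y → a y = y) (hb : ∀ y, y ≤ p → b y = y) :
    Commute a b := by
  ext y
  simp only [RelIso.mul_apply]
  rcases le_total y p with h | h
  · have : a y ≤ p := (a.monotone h).trans_eq (ha p le_rfl)
    rw [hb y h, hb _ this]
  · have : p ≤ b y := (hb p le_rfl).symm.trans_le (b.monotone h)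
    rw [ha y h, ha _ this]

theorem apply_apply_eq_self_iff_of_commute (h : Commute d a) (y : ℚ) :
    a (d y) = d y ↔ a y = y := by
  rw [← RelIso.mul_apply, ← h.eq, RelIso.mul_apply, d.injective.eq_iff]

theorem apply_eq_self_of_le_of_inv_le (h₁ : d p ≤ p) (h₂ : d⁻¹ p ≤ p) : d p = p :=
  le_antisymm h₁ (by simpa using d.monotone h₂)

theorem apply_eq_self_of_le_inv_of_le (h₁ : p ≤ d p) (h₂ : p ≤ d⁻¹ p) : d p = p :=
  le_antisymm (by simpa using d.monotone h₂) h₁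

theorem apply_eq_self_of_commute_of_fixed_iff_le (hb : ∀ y, b y = y ↔ y ≤ p)
    (h : Commute d b) : d p = p := by
  have key : ∀ e : ℚ ≃o ℚ, Commute e b → e p ≤ p := fun e he =>
    (hb _).1 ((apply_apply_eq_self_iff_of_commute he p).2 ((hb p).2 le_rfl))
  exact apply_eq_self_of_le_of_inv_le (key d h) (key _ h.inv_left)

theorem apply_eq_self_of_commute_of_fixed_iff_notMem_Ioo (hqp : q < p)
    (ha : ∀ y, a y = y ↔ y ≤ q ∨ p ≤ y) (h : Commute d a) : d p = p := by
  have key : ∀ e : ℚ ≃o ℚ, Commute e a → p ≤ e p := by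
    intro e he
    refine ((ha _).1 ((apply_apply_eq_self_iff_of_commute he p).2
      ((ha p).2 (.inr le_rfl)))).resolve_left fun hq => ?_
    have hlt : e ((q + p) / 2) < e p := e.strictMono (by linarith)
    have := (ha _).1 ((apply_apply_eq_self_iff_of_commute he _).1
      ((ha _).2 (.inl (hlt.le.trans hq))))
    rcases this with h | h <;> linarith
  exact apply_eq_self_of_le_inv_of_le (key d h) (key _ h.inv_left)

end OrderAutomorphisms

namespace ThompsonF

/-! ### A disjunctive law with constants -/

/-- If `a` is supported to the left and `b` to the right of a point `p`, then `s` pushes `p` either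
to the right, separating the support of `s * b * s⁻¹` from that of `a`, or to the left, separating
the support of `s * a * s⁻¹` from that of `b`. -/
theorem commute_conj_or_commute_conj {a b : ThompsonF} {p : ℚ}
    (ha : ∀ y, p ≤ y → action a y = y) (hb : ∀ y, y ≤ p → action b y = y) (s : ThompsonF) :
    Commute a (s * b * s⁻¹) ∨ Commute b (s * a * s⁻¹) := by
  have inj : ∀ {u v : ThompsonF}, Commute (action u) (action v) → Commute u v := fun h =>
    action_injective (by simpa only [map_mul] using h.eq)
  have hs : ∀ y, action s ((action s)⁻¹ y) = y := RelIso.apply_inv_self _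
  have hs' : ∀ y, (action s)⁻¹ (action s y) = y := RelIso.inv_apply_self _
  have conj_apply : ∀ (u : ThompsonF) (y : ℚ),
      action (s * u * s⁻¹) y = action s (action u ((action s)⁻¹ y)) := fun u y => by
    rw [map_mul, map_mul, map_inv, RelIso.mul_apply, RelIso.mul_apply]
  rcases le_total p (action s p) with h | h
  · refine .inl (inj (commute_of_fixed_Ici_Iic ha fun y hy => ?_))
    have : (action s)⁻¹ y ≤ p := by
      simpa only [hs'] using (action s)⁻¹.monotone (hy.trans h)
    rw [conj_apply, hb _ this, hs]
  · refine .inr (inj (Commute.symm (commute_of_fixed_Ici_Iic (fun y hy => ?_) hb)))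
    have : p ≤ (action s)⁻¹ y := by
      simpa only [hs'] using (action s)⁻¹.monotone (h.trans hy)
    rw [conj_apply, ha _ this, hs]

/-- Every nontrivial `c` moves a point `p` in the orbit of an integer, and there are elements `a`
and `b` whose supports lie on the two sides of `p` and both end exactly at `p`. An element that
commutes with `a` or with `b` has to fix `p`. -/
theorem exists_not_commute_forall_commute_conj {c : ThompsonF} (hc : c ≠ 1) :
    ∃ a b : ThompsonF, ¬ Commute c a ∧ ¬ Commute c b ∧
      ∀ s : ThompsonF, Commute a (s * b * s⁻¹) ∨ Commute b (s * a * s⁻¹) := by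
  have hc' : ¬ FixesOrbit c := fun h => hc (eq_one_of_fixesOrbit h)
  simp only [FixesOrbit, not_forall] at hc'
  obtain ⟨f, j, hj⟩ := hc'
  have conj_iff : ∀ u v : ThompsonF,
      Commute u (f * v * f⁻¹) ↔ Commute (f⁻¹ * u * f) v := fun u v => by
    rw [commute_iff_eq, commute_iff_eq, ← mul_right_inj f⁻¹, ← mul_left_inj f]
    simp only [mul_assoc, inv_mul_cancel_left, inv_mul_cancel, mul_one]
  set d := f⁻¹ * c * f
  have ha := action_x_mul_inv_eq_self_iff j
  have hb : ∀ y : ℚ, action (x (j + 2)) y = y ↔ y ≤ (j : ℚ) + 2 := fun y => by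
    rw [action_x_eq_self_iff]
    push_cast
    rfl
  refine ⟨f * (x j * (x (j + 1))⁻¹) * f⁻¹, f * x (j + 2) * f⁻¹, fun h => hj ?_, fun h => hj ?_,
    fun s => ?_⟩
  · rw [conj_iff] at h
    exact apply_eq_self_of_commute_of_fixed_iff_notMem_Ioo (by linarith) ha (h.map action)
  · rw [conj_iff] at h
    exact apply_eq_self_of_commute_of_fixed_iff_le hb (h.map action)
  · have key := commute_conj_or_commute_conj (fun y hy => (ha y).2 (.inr hy))
      (fun y hy => (hb y).2 hy) (f⁻¹ * s * f)
    have e : ∀ v, s * (f * v * f⁻¹) * s⁻¹ =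
        f * ((f⁻¹ * s * f) * v * (f⁻¹ * s * f)⁻¹) * f⁻¹ := fun v => by group
    have e' : ∀ v, f⁻¹ * (f * v * f⁻¹) * f = v := fun v => by group
    rwa [e, e, conj_iff, conj_iff, e', e']

end ThompsonF

/-! ### HNN-extensions along a conjugation -/

section HNN

variable {K : Type} [Group K] {H : Subgroup K} {α : H →* K} {hα : Function.Injective α}

theorem HNNOfEmbedding.t_ne_of (f : K) :
    (HNNExtension.t : HNNOfEmbedding H α hα) ≠ HNNExtension.of f := by
  intro h
  let w : HNNExtension.NormalWord.ReducedWord K H α.range := ⟨1, [(1, 1)], List.isChain_singleton _⟩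
  have := HNNExtension.ReducedWord.toList_eq_nil_of_mem_of_range (MonoidHom.ofInjective hα) w
    ⟨f, by simp [w, HNNExtension.NormalWord.ReducedWord.prod, h]⟩
  simp [w] at this

/-- If `α` is conjugation by `f`, then `s = f⁻¹ * t` centralises `H`, and by Britton's lemma the
commutator of `a` and `s * b * s⁻¹` is nontrivial when `a` and `b` lie outside of `H`. -/
theorem HNNOfEmbedding.not_commute_of_notMem {f : K} (hf : ∀ h : H, α h = f * h * f⁻¹)
    {a b : K} (ha : a ∉ H) (hb : b ∉ H) :
    ¬ Commute (HNNExtension.of a : HNNOfEmbedding H α hα)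
      ((HNNExtension.of f)⁻¹ * HNNExtension.t * HNNExtension.of b *
        ((HNNExtension.of f)⁻¹ * HNNExtension.t)⁻¹) := by
  intro h
  have ha' : f * a⁻¹ * f⁻¹ ∉ α.range := by
    rintro ⟨k, hk⟩
    rw [hf] at hk
    have : (k : K) = a⁻¹ := by simpa using hk
    exact ha (H.inv_mem_iff.1 (this ▸ k.2))
  let w : HNNExtension.NormalWord.ReducedWord K H α.range :=
    ⟨a * f⁻¹, [(1, b), (-1, f * a⁻¹ * f⁻¹), (1, b⁻¹), (-1, f)], by
      simp [HNNExtension.toSubgroup, hb, ha']⟩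
  have := HNNExtension.ReducedWord.toList_eq_nil_of_mem_of_range (MonoidHom.ofInjective hα) w ⟨1, by
    rw [commute_iff_eq, ← mul_inv_eq_one] at h
    rw [map_one, ← h]
    simp [w, HNNExtension.NormalWord.ReducedWord.prod, mul_assoc]⟩
  simp [w] at this

end HNN

/-! ### Convergence of marked groups -/

/-- In a convergent sequence of marked groups, every word is eventually a relation of the terms
exactly when it is a relation of the limit. -/
theorem MarkedGroup.eventually_isRelation_iff {k : ℕ} {M : ℕ → MarkedGroup k} {G : MarkedGroup k}
    (h : Tendsto M atTop (𝓝 G)) (w : FreeGroup (Fin k)) :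
    ∀ᶠ n in atTop, ((M n).IsRelation w ↔ G.IsRelation w) := by
  filter_upwards [(Metric.tendsto_nhds.1 h) _ (Real.exp_pos (-(w.norm : ℝ)))] with n hn
  exact (MarkedGroup.markedDist_le_exp_iff w.norm (M n) G).1 (le_of_lt hn) w le_rfl

theorem theorem4p7 (g : ℕ → ThompsonF) (G : MarkedGroup 3)
    (hG : Tendsto (fun n => ThompsonF.marked (g n)) atTop (𝓝 G))
    (H : Subgroup ThompsonF) (hH : H.FG) (α : H →* ThompsonF) (hα : Function.Injective α) :
    ¬ ∃ e : G.carrier ≃* HNNOfEmbedding H α hα,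
      e (G.gens 1) = HNNExtension.of (ThompsonF.x 0) ∧
      e (G.gens 2) = HNNExtension.of (ThompsonF.x 1) := by
  rintro ⟨e, he1, he2⟩
  -- Evaluation of words in the terms of the sequence and in the HNN-extension.
  let ψ : ℕ → FreeGroup (Fin 3) →* ThompsonF := fun n =>
    FreeGroup.lift ![g n, ThompsonF.x 0, ThompsonF.x 1]
  let Ψ : FreeGroup (Fin 3) →* HNNOfEmbedding H α hα :=
    e.toMonoidHom.comp (FreeGroup.lift G.gens)
  have transfer : ∀ u v : FreeGroup (Fin 3), ∀ᶠ n in atTop, (ψ n u = ψ n v ↔ Ψ u = Ψ v) := by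
    intro u v
    filter_upwards [MarkedGroup.eventually_isRelation_iff hG (u * v⁻¹)] with n hn
    have h1 : ψ n u = ψ n v ↔ ψ n (u * v⁻¹) = 1 := by rw [map_mul, map_inv, mul_inv_eq_one]
    have h2 : Ψ u = Ψ v ↔ FreeGroup.lift G.gens (u * v⁻¹) = 1 := by
      rw [map_mul, map_inv, mul_inv_eq_one]
      exact e.injective.eq_iff
    rw [h1, h2]
    exact hn
  have constants : ∀ k : ThompsonF, ∃ w : FreeGroup (Fin 3),
      (∀ n, ψ n w = k) ∧ Ψ w = HNNExtension.of k := by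
    intro k
    have hk : k ∈ Subgroup.closure ({ThompsonF.x 0, ThompsonF.x 1} : Set ThompsonF) := by
      rw [ThompsonF.closure_x_zero_x_one]
      trivial
    induction hk using Subgroup.closure_induction with
    | mem y hy =>
      rcases hy with rfl | rfl
      · exact ⟨FreeGroup.of 1, fun n => by simp [ψ], by simp [Ψ, he1]⟩
      · exact ⟨FreeGroup.of 2, fun n => by simp [ψ], by simp [Ψ, he2]⟩
    | one => exact ⟨1, by simp⟩
    | mul y z _ _ ihy ihz =>
      obtain ⟨u, hu, hu'⟩ := ihy
      obtain ⟨v, hv, hv'⟩ := ihz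
      exact ⟨u * v, fun n => by rw [map_mul, hu, hv], by rw [map_mul, map_mul, hu', hv']⟩
    | inv y _ ih =>
      obtain ⟨u, hu, hu'⟩ := ih
      exact ⟨u⁻¹, fun n => by rw [map_inv, hu], by rw [map_inv, map_inv, hu']⟩
  choose κ hκ hκ' using constants
  obtain ⟨τ, hτ⟩ : ∃ τ, Ψ τ = HNNExtension.t := by
    have : e.symm HNNExtension.t ∈ (FreeGroup.lift G.gens).range := by
      rw [FreeGroup.range_lift_eq_closure, G.closure_range_gens]
      trivial
    obtain ⟨τ, hτ⟩ := this
    exact ⟨τ, by simp [Ψ, hτ]⟩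
  have conj_eq : ∀ᶠ n in atTop, ∀ h : H, α h = ψ n τ * h * (ψ n τ)⁻¹ := by
    obtain ⟨S, hS⟩ := (Group.fg_iff_subgroup_fg H).2 hH
    have hev : ∀ᶠ n in atTop, ∀ h ∈ S, α h = ψ n τ * h * (ψ n τ)⁻¹ := by
      refine (Filter.eventually_all_finset S).2 fun h _ => ?_
      filter_upwards [transfer (κ (α h)) (τ * κ h * τ⁻¹)] with n hn
      have := hn.2 (by
        simp only [map_mul, map_inv, hκ', hτ]
        rw [eq_mul_inv_iff_mul_eq]
        exact (HNNExtension.t_mul_of h).symm)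
      simpa only [map_mul, map_inv, hκ] using this
    filter_upwards [hev] with n hn h
    have : α = (MulAut.conj (ψ n τ)).toMonoidHom.comp H.subtype :=
      MonoidHom.eq_of_eqOn_dense hS fun h hh => hn h hh
    exact DFunLike.congr_fun this h
  obtain ⟨N, hN⟩ := eventually_atTop.1 conj_eq
  -- `α` is conjugation by `f`, so `f⁻¹ * ψ n τ` centralises `H` for every `n ≥ N`.
  set f := ψ N τ
  by_cases hC : ∃ c : ThompsonF, c ≠ 1 ∧ ∀ h ∈ H, Commute c h
  · -- Here `s = f⁻¹ * t` is a limit of elements of `F`, each of which satisfies one of two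
    -- commutation relations with constants from outside of `H`; neither holds for `s` itself.
    obtain ⟨c, hc, hcH⟩ := hC
    obtain ⟨a, b, hca, hcb, law⟩ := ThompsonF.exists_not_commute_forall_commute_conj hc
    have ha : a ∉ H := fun h => hca (hcH a h)
    have hb : b ∉ H := fun h => hcb (hcH b h)
    have never : ∀ a b : ThompsonF, a ∉ H → b ∉ H → ∀ᶠ n in atTop,
        ¬ Commute a ((f⁻¹ * ψ n τ) * b * (f⁻¹ * ψ n τ)⁻¹) := by
      intro a b ha hb
      let v := ((κ f)⁻¹ * τ) * κ b * ((κ f)⁻¹ * τ)⁻¹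
      filter_upwards [transfer (κ a * v) (v * κ a)] with n hn h
      refine HNNOfEmbedding.not_commute_of_notMem (hN N le_rfl) ha hb (hα := hα) ?_
      have := hn.1 (by simpa only [v, map_mul, map_inv, hκ] using h.eq)
      simp only [v, map_mul, map_inv, hκ', hτ] at this
      exact this
    obtain ⟨n, h1, h2⟩ := ((never a b ha hb).and (never b a hb ha)).exists
    exact (law _).elim h1 h2
  · -- Here the values of `t` centralise `H` up to `f`, so they are eventually equal to `f`.
    obtain ⟨n, hn, hnN⟩ := ((transfer τ (κ f)).and (eventually_ge_atTop N)).exists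
    refine HNNOfEmbedding.t_ne_of f (hα := hα) ?_
    rw [← hτ, ← hκ']
    refine hn.1 ?_
    rw [hκ]
    by_contra hne
    refine hC ⟨f⁻¹ * ψ n τ, fun h => hne (inv_mul_eq_one.1 h).symm, fun h hh => ?_⟩
    have h1 := (hN N le_rfl ⟨h, hh⟩).symm.trans (hN n hnN ⟨h, hh⟩)
    have h2 : ψ n τ * h = f * h * f⁻¹ * ψ n τ := by
      rw [← mul_inv_eq_iff_eq_mul]
      exact h1.symm
    rw [commute_iff_eq, mul_assoc, h2]
    group
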